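/- For bounded operators $A_1,\dots,A_k$ on a complex Hilbert space let $\sigma_p(A_1,\dots,A_k)=\{x\in\mathbb C^k: x_1A_1+\dots+x_kA_k-I \text{ is not invertible}\}$. A point $x$ of $\sigma_p(A_1,\dots,A_k)$ is said to have multiplicity $m$ if $1$ is an isolated point of the spectrum of $A(x)=x_1A_1+\dots+x_kA_k$ and the spectral projection $\frac1{2\pi i}\int_{|w-1|=\rho}(w-A(x))^{-1}dw$ ($\rho>0$ small) has rank $m$. Let $\Delta_4(\tau,\epsilon)=\{w\in\mathbb C^4: |w_i-\tau_i|<\epsilon,\ i=1,\dots,4\}$. **Theorem.** Let $n\ge 1$ be an integer and $\omega=e^{2\pi i/n}$. Let $A$ be a bounded normal operator and $B$ a bounded operator of norm one on a complex Hilbert space $H$. Put $$S=\{(x,y,z_1,z_2)\in\mathbb C^4: x^n+y^n+(-1)^{n-1}(\omega z_1+z_2)^n=1\},$$ $\tau_{1j}=(\omega^j,0,0,0)$ and $\tau_{2j}=(0,\omega^j,0,0)$ for $j=0,\dots,n-1$. Suppose that there is an $\epsilon>0$ such that for $m=1,2$ and $j=0,\dots,n-1$ 1. $\sigma_p(A,B,AB,BA)\cap\Delta_4(\tau_{mj},\epsilon)=S\cap\Delta_4(\tau_{mj},\epsilon)$,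 and 2. every point of $S\cap\Delta_4(\tau_{mj},\epsilon)$ has multiplicity one in $\sigma_p(A,B,AB,BA)$. Then there is a subspace $L\subset H$ of dimension $n$, invariant under $A$ and $B$, such that (a) the pair $(A|_L,B|_L)$ is unitarily equivalent to the pair of $n\times n$ matrices $$\operatorname{diag}(1,\omega,\dots,\omega^{n-1}),\qquad \begin{bmatrix}0&0&\cdots&0&1\\1&0&\cdots&0&0\\0&1&\cdots&0&0\\ \vdots&&\ddots&&\vdots\\0&0&\cdots&1&0\end{bmatrix};$$ (b) $L$ has an orthonormal basis $e_0,\dots,e_{n-1}$ with $Ae_j=\omega^je_j$ and an orthonormal basis $\zeta_0,\dots,\zeta_{n-1}$ with $B\zeta_j=\omega^j\zeta_j$, and for any two such bases the matrix $C$ whose $k$-th column consists of the coefficients of $e_k$ in the basis $\zeta_0,\dots,\zeta_{n-1}$ satisfies $\sqrt n\,C=\Lambda_1F_n\Lambda_2$, where $F_n=[\omega^{jk}]_{j,k=0}^{n-1}$ and $\Lambda_1,\Lambda_2$ are diagonal matrices with unimodular diagonal entries. -/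

import Mathlib

open scoped Real

noncomputable section

/-- The proper projective joint spectrum of a tuple `T₁, …, T_k` of bounded operators: the set of
`x ∈ ℂᵏ` such that `x₁ T₁ + ⋯ + x_k T_k - I` is not invertible. -/
def properJointSpectrum {H : Type*} [NormedAddCommGroup H] [InnerProductSpace ℂ H] {k : ℕ}
    (T : Fin k → (H →L[ℂ] H)) : Set (Fin k → ℂ) :=
  {x | ¬ IsUnit (∑ i, x i • T i - 1)}

/-- The open polydisk of radius `r` centered at `x`. -/
def polydisk {k : ℕ} (x : Fin k → ℂ) (r : ℝ) : Set (Fin k → ℂ) :=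
  {w | ∀ i, ‖w i - x i‖ < r}

/-- The operator `(2πi)⁻¹ ∮ (w - S)⁻¹ dw`, the integral being over the circle `|w - c| = r`. -/
def rieszProjection {H : Type*} [NormedAddCommGroup H] [InnerProductSpace ℂ H]
    (S : H →L[ℂ] H) (c : ℂ) (r : ℝ) : H →L[ℂ] H :=
  (2 * π * Complex.I : ℂ)⁻¹ • circleIntegral (fun w : ℂ => resolvent S w) c r

/-- `c` is an isolated point of the spectrum of `S` and its (algebraic) multiplicity, the rank of
the corresponding spectral projection, is equal to `m`. -/
def IsIsolatedSpectralPointOfMultiplicity {H : Type*} [NormedAddCommGroup H]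
    [InnerProductSpace ℂ H] (S : H →L[ℂ] H) (c : ℂ) (m : ℕ) : Prop :=
  ∃ r : ℝ, 0 < r ∧ Metric.closedBall c r ∩ spectrum ℂ S = {c} ∧
    Module.rank ℂ (LinearMap.range (rieszProjection S c r).toLinearMap) = m

/-- The point `x` of the proper projective joint spectrum of `T₁, …, T_k` has multiplicity `m`:
`1` is an isolated point of multiplicity `m` of the spectrum of `x₁ T₁ + ⋯ + x_k T_k`. -/
def HasJointMultiplicity {H : Type*} [NormedAddCommGroup H] [InnerProductSpace ℂ H] {k : ℕ}
    (T : Fin k → (H →L[ℂ] H)) (x : Fin k → ℂ) (m : ℕ) : Prop :=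
  IsIsolatedSpectralPointOfMultiplicity (∑ i, x i • T i) 1 m

/-- The primitive root of unity `e^{2πi/n}`. -/
def rootOfUnity (n : ℕ) : ℂ := Complex.exp (2 * π * Complex.I / n)

/-- The surface `xⁿ + yⁿ + (-1)ⁿ⁻¹ (ω z₁ + z₂)ⁿ = 1` in `ℂ⁴`, where `ω = e^{2πi/n}`; the exponent
`n - 1` is only used for `n ≥ 1`. -/
def fourierSurface (n : ℕ) : Set (Fin 4 → ℂ) :=
  {p | p 0 ^ n + p 1 ^ n + (-1) ^ (n - 1) * (rootOfUnity n * p 2 + p 3) ^ n = 1}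

/-- The Fourier matrix `Fₙ`, with entries `ω ^ (j k)`, `0 ≤ j, k ≤ n - 1`. -/
def fourierMatrix (n : ℕ) : Matrix (Fin n) (Fin n) ℂ :=
  Matrix.of fun j k => rootOfUnity n ^ ((j : ℕ) * (k : ℕ))

/-- The matrix `diag (1, ω, …, ωⁿ⁻¹)`. -/
def clockMatrix (n : ℕ) : Matrix (Fin n) (Fin n) ℂ :=
  Matrix.diagonal fun j => rootOfUnity n ^ (j : ℕ)

/-- The matrix of the cyclic shift that sends the `k`-th basis vector to the `(k+1)`-st one and the
last basis vector to the first one. -/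
def shiftMatrix (n : ℕ) : Matrix (Fin n) (Fin n) ℂ :=
  Matrix.of fun j k => if (j : ℕ) = ((k : ℕ) + 1) % n then 1 else 0

/-- The pair of operators `(S, T)` on a space is unitarily equivalent to the pair of matrices
`(M, N)`. -/
def PairUnitarilyEquivalent {V : Type*} [NormedAddCommGroup V] [InnerProductSpace ℂ V] {n : ℕ}
    (S T : V →ₗ[ℂ] V) (M N : Matrix (Fin n) (Fin n) ℂ) : Prop :=
  ∃ U : V ≃ₗᵢ[ℂ] EuclideanSpace ℂ (Fin n),
    (∀ v, U (S v) = Matrix.toEuclideanLin M (U v)) ∧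
    (∀ v, U (T v) = Matrix.toEuclideanLin N (U v))

/-- `e₀, …, eₙ₋₁` is an orthonormal basis consisting of eigenvectors of `S` with
`S eⱼ = e^{2πij/n} eⱼ`. -/
def IsRootOfUnityEigenbasis {V : Type*} [NormedAddCommGroup V] [InnerProductSpace ℂ V] {n : ℕ}
    (S : V →ₗ[ℂ] V) (e : OrthonormalBasis (Fin n) ℂ V) : Prop :=
  ∀ j, S (e j) = rootOfUnity n ^ (j : ℕ) • e j

/-- The transition matrix from the basis `e` to the basis `ζ`: its `k`-th column consists of the
coefficients of the decomposition of `eₖ` in the basis `ζ₀, …, ζₙ₋₁`. -/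
def transitionMatrix {V : Type*} [NormedAddCommGroup V] [InnerProductSpace ℂ V] {n : ℕ}
    (e ζ : OrthonormalBasis (Fin n) ℂ V) : Matrix (Fin n) (Fin n) ℂ :=
  Matrix.of fun j k => ζ.repr (e k) j

end

/-! ### Spectral projections at a simple isolated point of the spectrum -/

section JointSpectrum

open Filter Topology

variable {H : Type*} [NormedAddCommGroup H] [InnerProductSpace ℂ H]

/-! Let `x₀ⁿ = 1`. Normality of `A` and multiplicity one at `(x₀, 0, 0, 0)` give a unit vector `e`
with `x₀ A e = e` for which the spectral projection is `v ↦ ⟨e, v⟩ e`. For small `α` the surface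
contains `(x₀, α, -α x₀, 0)`, where the pencil factors as `(1 - x₀ A)(1 - α B)`. The pencil stays
singular along curves of the surface through this point, so first-order perturbation theory
(`inner_apply_eq_zero_of_tendsto`) constrains `u = (1 - α B)⁻¹ e` for each tangent direction
(`inner_tangent_eq`). Comparing powers of `α` gives `⟨e, Bⁿ e⟩ = 1` and `⟨e, B A Bⁿ⁻¹ e⟩ = (ω
x₀)ⁿ⁻¹` (`inner_pow_apply_eq`).

Since `B` is a contraction, equality in Cauchy–Schwarz yields `Bⁿ e = e` and `B* e = Bⁿ⁻¹ e`, so the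
second identity is the mean value of `A` at the unit vector `Bⁿ⁻¹ e`. Multiplicity one at the points
`(0, x₀, 0, 0)` bounds `dim ker (Bⁿ - 1)` by `n`; hence this kernel is spanned by the `n`
orthonormal eigenvectors of `A`, and `A` is isometric on it. A second use of Cauchy–Schwarz makes
`Bⁿ⁻¹ e` an eigenvector of `A`. Thus `Bⁿ⁻¹` permutes the eigenlines of `A` cyclically, which is the
clock and shift pair (`exists_cyclic_eigenvectors`). The Fourier matrix is the change of basis
diagonalizing the shift. -/

theorem rieszProjection_apply_of_eigenvector [CompleteSpace H] {S : H →L[ℂ] H} {c : ℂ} {r : ℝ}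
    (hr : 0 < r) (hspec : Metric.closedBall c r ∩ spectrum ℂ S = {c}) {v : H}
    (hv : S v = c • v) : rieszProjection S c r v = v := by
  have hres : ∀ w ∈ Metric.sphere c r, w ∈ resolventSet ℂ S := by
    intro w hw
    by_contra hns
    have : w ∈ Metric.closedBall c r ∩ spectrum ℂ S := ⟨Metric.sphere_subset_closedBall hw, hns⟩
    rw [hspec] at this
    simp only [Set.mem_singleton_iff] at this
    subst this
    simp at hw
    exact hr.ne hw
  have hcont : ContinuousOn (fun w : ℂ => resolvent S w) (Metric.sphere c r) := by
    intro w hw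
    have := spectrum.hasDerivAt_resolvent_const_left (hres w hw)
    exact this.continuousAt.continuousWithinAt
  have hint : CircleIntegrable (fun w : ℂ => resolvent S w) c r :=
    hcont.circleIntegrable hr.le
  -- On an eigenvector the resolvent is the scalar `(w - c)⁻¹`, so the contour integral reduces to
  -- Cauchy's formula.
  have hev : ∀ w ∈ Metric.sphere c r, resolvent S w v = (w - c)⁻¹ • v := by
    intro w hw
    have hu : IsUnit (algebraMap ℂ (H →L[ℂ] H) w - S) := hres w hw
    have hne : w - c ≠ 0 := by
      intro h
      rw [sub_eq_zero] at h
      subst h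
      simp at hw
      exact hr.ne hw
    have h1 : (algebraMap ℂ (H →L[ℂ] H) w - S) v = (w - c) • v := by
      simp [Algebra.algebraMap_eq_smul_one, hv, sub_smul]
    have h2 : resolvent S w ((algebraMap ℂ (H →L[ℂ] H) w - S) v) = v := by
      rw [resolvent, ← mul_apply_eq_comp, Ring.inverse_mul_cancel _ hu]
      simp
    rw [h1, map_smul] at h2
    rw [eq_inv_smul_iff₀ hne, h2]
  have happ : circleIntegral (fun w : ℂ => resolvent S w) c r v =
      circleIntegral (fun w : ℂ => resolvent S w v) c r := by
    have := ContinuousLinearMap.intervalIntegral_comp_comm (ContinuousLinearMap.apply ℂ H v)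
      hint.out
    simpa [circleIntegral] using this.symm
  rw [rieszProjection, smul_apply, happ,
    circleIntegral.integral_congr hr.le hev, circleIntegral.integral_smul_const,
    circleIntegral.integral_sub_center_inv c hr.ne', smul_smul, inv_mul_cancel₀, one_smul]
  simp [Real.pi_ne_zero]

/-- The Riesz projection fixes eigenvectors, so the eigenspace lies in its one-dimensional range.
The rank in the multiplicity hypothesis enters the proof only through this. -/
theorem exists_smul_eq_of_isIsolatedSpectralPoint [CompleteSpace H] {S : H →L[ℂ] H} {c : ℂ}
    (hS : IsIsolatedSpectralPointOfMultiplicity S c 1) {v w : H} (hv0 : v ≠ 0)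
    (hv : S v = c • v) (hw : S w = c • w) : ∃ d : ℂ, w = d • v := by
  obtain ⟨r, hr, hspec, hrank⟩ := hS
  have hmem : ∀ x : H, S x = c • x →
      x ∈ LinearMap.range (rieszProjection S c r).toLinearMap := fun x hx =>
    ⟨x, rieszProjection_apply_of_eigenvector hr hspec hx⟩
  have hfin : Module.finrank ℂ (LinearMap.range (rieszProjection S c r).toLinearMap) = 1 :=
    Module.finrank_eq_of_rank_eq (by simpa using hrank)
  obtain ⟨d, hd⟩ := exists_smul_eq_of_finrank_eq_one hfin
    (x := ⟨v, hmem v hv⟩) (by simpa using hv0) ⟨w, hmem w hw⟩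
  exact ⟨d, (congrArg Subtype.val hd).symm⟩

/-- The operator `v ↦ ⟨e, v⟩ e`, the orthogonal projection onto `ℂ e` when `e` is a unit vector. -/
noncomputable def rankOneOperator (e : H) : H →L[ℂ] H := (innerSL ℂ e).smulRight e

@[simp]
theorem rankOneOperator_apply (e v : H) : rankOneOperator e v = inner ℂ e v • e := rfl

/-- An isolated point of the spectrum of a normal operator is an eigenvalue, and the spectral
projection onto a simple eigenspace is orthogonal. -/
theorem IsStarNormal.isUnit_one_sub_add_rankOneOperator [CompleteSpace H] {S : H →L[ℂ] H}
    (hN : IsStarNormal S) (hS : IsIsolatedSpectralPointOfMultiplicity S 1 1) :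
    (∃ e : H, ‖e‖ = 1 ∧ S e = e) ∧
      ∀ e : H, ‖e‖ = 1 → S e = e → IsUnit (1 - S + rankOneOperator e) := by
  obtain ⟨r, hr, hspec, -⟩ := id hS
  -- Isolation of `1` makes its indicator continuous on the spectrum. The resulting `Q` is a
  -- self-adjoint idempotent with range fixed by `S`, and `1 - S + Q` is invertible because `1 - z +
  -- f z` never vanishes on the spectrum.
  let f : ℂ → ℂ := fun z => if z = 1 then 1 else 0
  have hcont : ContinuousOn f (spectrum ℂ S) := by
    intro z hz
    by_cases h1 : z = 1
    · subst h1
      have : f =ᶠ[𝓝[spectrum ℂ S] 1] fun _ => 1 := by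
        filter_upwards [self_mem_nhdsWithin,
          mem_nhdsWithin_of_mem_nhds (Metric.closedBall_mem_nhds (1 : ℂ) hr)] with w hw hw'
        have : w ∈ Metric.closedBall (1 : ℂ) r ∩ spectrum ℂ S := ⟨hw', hw⟩
        rw [hspec] at this
        simp only [Set.mem_singleton_iff] at this
        simp [f, this]
      exact (continuousWithinAt_const (b := (1 : ℂ))).congr_of_eventuallyEq this (by simp [f])
    · have : f =ᶠ[𝓝 z] fun _ => 0 := by
        filter_upwards [isOpen_ne.mem_nhds h1] with w hw
        exact if_neg hw
      exact (continuousAt_const.congr this.symm).continuousWithinAt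
  set Q : H →L[ℂ] H := cfc f S with hQ
  have hone : cfc (fun z : ℂ => 1 - z) S = 1 - S := by
    rw [cfc_sub (fun _ => 1) (fun z => z) S, cfc_const_one ℂ S, cfc_id' ℂ S]
  have hQQ : Q * Q = Q := by
    rw [hQ, ← cfc_mul f f S]
    congr 1
    ext z
    simp [f]
  have hQstar : star Q = Q := by
    rw [hQ, ← cfc_star]
    congr 1
    ext z
    by_cases h : z = 1 <;> simp [f, h]
  have hSQ : (1 - S) * Q = 0 := by
    rw [hQ, ← hone, ← cfc_mul _ f S]
    rw [← cfc_const_zero ℂ S]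
    congr 1
    ext z
    by_cases h : z = 1 <;> simp [f, h]
  have hunit : IsUnit (1 - S + Q) := by
    rw [hQ, ← hone, ← cfc_add S _ f, isUnit_cfc_iff _ S]
    intro z hz
    by_cases h : z = 1
    · simp [f, h]
    · simpa [f, h, sub_eq_zero] using Ne.symm h
  have hnon : ¬ IsUnit (1 - S) := by
    have : (1 : ℂ) ∈ Metric.closedBall (1 : ℂ) r ∩ spectrum ℂ S := by rw [hspec]; rfl
    simpa [spectrum.mem_iff] using this.2
  have hfix : ∀ v, S (Q v) = Q v := by
    intro v
    have := DFunLike.congr_fun hSQ v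
    simp only [mul_apply_eq_comp, sub_apply,
      one_apply_eq_self, zero_apply] at this
    exact (sub_eq_zero.1 this).symm
  refine ⟨?_, ?_⟩
  · have hQ0 : Q ≠ 0 := by
      intro h
      rw [h, add_zero] at hunit
      exact hnon hunit
    obtain ⟨v, hv⟩ : ∃ v, Q v ≠ 0 := by
      by_contra! h
      exact hQ0 (ContinuousLinearMap.ext h)
    refine ⟨(‖Q v‖⁻¹ : ℂ) • Q v, ?_, ?_⟩
    · rw [norm_smul]
      simp [hv]
    · rw [map_smul, hfix]
  · intro e he hSe
    have he0 : e ≠ 0 := by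
      rintro rfl
      simp at he
    have hsimple : ∀ v, ∃ d : ℂ, Q v = d • e := fun v =>
      exists_smul_eq_of_isIsolatedSpectralPoint hS he0 (by simpa using hSe)
        (by simpa using hfix v)
    have hQe : Q e = e := by
      obtain ⟨c, hc⟩ := hsimple e
      have h1 : Q (Q e) = Q e := by
        rw [← mul_apply_eq_comp, hQQ]
      -- If `c = 0`, the invertible operator `1 - S + Q` would kill `e`.
      have hc0 : c ≠ 0 := by
        rintro rfl
        obtain ⟨U, hU⟩ := hunit
        have h2 : (↑U⁻¹ * (1 - S + Q)) e = e := by rw [← hU]; simp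
        simp [hSe, hc] at h2
        exact he0 h2.symm
      rw [hc, map_smul, hc] at h1
      have h3 := smul_right_injective H hc0 h1
      rw [hc]
      exact h3
    have : Q = rankOneOperator e := by
      ext v
      obtain ⟨d, hd⟩ := hsimple v
      have h1 : inner ℂ e (Q v) = inner ℂ e v := by
        rw [← ContinuousLinearMap.adjoint_inner_left, ← ContinuousLinearMap.star_eq_adjoint,
          hQstar, hQe]
      rw [rankOneOperator_apply, ← h1, hd, inner_smul_right, inner_self_eq_norm_sq_to_K, he]
      simp
    rw [← this]
    exact hunit

/-! ### Perturbation of a simple eigenvalue -/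

theorem isUnit_sub_mul_of_mul_mul_eq_smul {R : Type*} [Ring R] [Algebra ℂ R] (K : Rˣ) (P N : R)
    {c : ℂ} (hc : c ≠ 1) (h : P * (N * ↑K⁻¹) * P = c • P) : IsUnit (↑K - P * N) := by
  have hc' : 1 - c ≠ 0 := sub_ne_zero.2 (Ne.symm hc)
  set X := N * ↑K⁻¹ with hX
  -- `P X` is a multiple of an idempotent up to the degenerate case `c = 0`, so the geometric series
  -- for `(1 - P X)⁻¹` collapses to `1 + (1 - c)⁻¹ P X`.
  have hPX : P * X * (P * X) = c • (P * X) := by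
    rw [← mul_assoc, h, smul_mul_assoc]
  have h1 : (1 - P * X) * (1 + (1 - c)⁻¹ • (P * X)) = 1 := by
    have : (1 - P * X) * (1 + (1 - c)⁻¹ • (P * X)) =
        1 + ((1 - c)⁻¹ • (P * X) - P * X - (1 - c)⁻¹ • (P * X * (P * X))) := by
      simp only [sub_mul, mul_add, mul_one, one_mul, mul_smul_comm, smul_sub]
      abel
    rw [this, hPX, smul_smul]
    have h0 : (1 - c)⁻¹ • (P * X) - P * X - ((1 - c)⁻¹ * c) • (P * X) =
        ((1 - c)⁻¹ - 1 - (1 - c)⁻¹ * c) • (P * X) := by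
      simp only [sub_smul, one_smul]
    rw [h0, show (1 - c)⁻¹ - 1 - (1 - c)⁻¹ * c = 0 by field_simp; ring]
    simp
  have h2 : (1 + (1 - c)⁻¹ • (P * X)) * (1 - P * X) = 1 := by
    refine Eq.trans ?_ h1
    simp only [add_mul, sub_mul, mul_add, mul_sub, mul_one, one_mul, mul_smul_comm,
      smul_mul_assoc, smul_sub]
    abel
  have h3 : IsUnit (1 - P * X) := ⟨⟨_, _, h1, h2⟩, rfl⟩
  have h4 : (K : R) - P * N = (1 - P * X) * K := by
    rw [sub_mul, one_mul, hX, mul_assoc, mul_assoc, Units.inv_mul, mul_one]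
  rw [h4]
  exact h3.mul K.isUnit

/-- First order perturbation theory of a simple eigenvalue. -/
theorem inner_apply_eq_zero_of_tendsto [CompleteSpace H] {ι : Type*} {l : Filter ι} [l.NeBot]
    {G N D : H →L[ℂ] H} {e u : H} (he : ‖e‖ = 1) (hGe : G e = 0)
    (hG : ∀ v, inner ℂ e (G v) = 0) (hunit : IsUnit (G + rankOneOperator e)) (hN : IsUnit N)
    (hu : N u = e) {s : ι → ℂ} {T : ι → H →L[ℂ] H} (hs : Tendsto s l (𝓝 0))
    (hs0 : ∀ᶠ i in l, s i ≠ 0) (hT : Tendsto T l (𝓝 D))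
    (hsing : ∀ᶠ i in l, ¬ IsUnit (G * N - s i • T i)) : inner ℂ e (D u) = 0 := by
  have hee : inner ℂ e e = (1 : ℂ) := by rw [inner_self_eq_norm_sq_to_K, he]; simp
  -- With `P` the projection onto `e` and `K = (G + P) N`, the singular operator is `(K - s T) - P
  -- N`, a rank-one perturbation of an operator that is eventually invertible. Singularity is then
  -- the scalar condition `⟨e, N w⟩ = 1` for `w = (K - s T)⁻¹ e`. Since `e` is orthogonal to the
  -- range of `G`, this turns into `s ⟨e, T w⟩ = 0`, and `w` tends to `K⁻¹ e = u`.
  obtain ⟨K, hK⟩ : IsUnit ((G + rankOneOperator e) * N) := hunit.mul hN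
  have hKu : K.val u = e := by
    rw [hK, mul_apply_eq_comp, hu]
    simp [hGe, he]
  have hlim : Tendsto (fun i => K.val - s i • T i) l (𝓝 K.val) := by
    simpa using tendsto_const_nhds.sub (hs.smul hT)
  have hinv : Tendsto (fun i => Ring.inverse (K.val - s i • T i)) l (𝓝 (Ring.inverse K.val)) :=
    (NormedRing.inverse_continuousAt K).tendsto.comp hlim
  have hw : Tendsto (fun i => T i (Ring.inverse (K.val - s i • T i) e)) l
      (𝓝 (D (Ring.inverse K.val e))) := by
    have h1 : Tendsto (fun i => Ring.inverse (K.val - s i • T i) e) l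
        (𝓝 (Ring.inverse K.val e)) :=
      ((ContinuousLinearMap.apply ℂ H e).continuous.tendsto _).comp hinv
    exact (isBoundedBilinearMap_apply (𝕜 := ℂ) (E := H) (F := H)).continuous.tendsto
      (D, Ring.inverse K.val e) |>.comp (hT.prodMk_nhds h1)
  have hKe : Ring.inverse K.val e = u := by
    rw [← hKu, ← mul_apply_eq_comp, Ring.inverse_mul_cancel _ K.isUnit]
    simp
  rw [hKe] at hw
  have hin : Tendsto (fun i => inner ℂ e (T i (Ring.inverse (K.val - s i • T i) e))) l
      (𝓝 (inner ℂ e (D u))) := tendsto_const_nhds.inner hw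
  refine tendsto_nhds_unique hin (tendsto_const_nhds.congr' ?_)
  have hopen : ∀ᶠ i in l, IsUnit (K.val - s i • T i) :=
    hlim.eventually (Units.isOpen.mem_nhds K.isUnit)
  filter_upwards [hs0, hsing, hopen] with i hi0 hi hiu
  obtain ⟨V, hV⟩ := hiu
  rw [← hV, Ring.inverse_unit]
  set w := (V⁻¹).val e with hwdef
  have hVw : V.val w = e := by
    rw [hwdef, ← mul_apply_eq_comp, Units.mul_inv]
    simp
  have hone : inner ℂ e (N w) = (1 : ℂ) := by
    by_contra hne
    apply hi
    have hsub : G * N - s i • T i = V.val - rankOneOperator e * N := by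
      rw [hV, hK, add_mul]
      abel
    rw [hsub]
    refine isUnit_sub_mul_of_mul_mul_eq_smul V _ N hne ?_
    ext v
    simp [hwdef, smul_smul, mul_comm]
  have hKw : K.val w = e + s i • T i w := by
    rw [← hVw, hV]
    simp
  have h1 : inner ℂ e (K.val w) = (1 : ℂ) := by
    rw [hK, mul_apply_eq_comp, add_apply, inner_add_right, hG,
      rankOneOperator_apply, hone]
    simp [he]
  rw [hKw, inner_add_right, hee, inner_smul_right] at h1
  have h2 : s i * inner ℂ e (T i w) = 0 := by linear_combination h1
  exact ((mul_eq_zero.1 h2).resolve_left hi0).symm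

/-! ### Comparison of power series coefficients -/

theorem eq_of_hasSum_pow_mul {a b : ℕ → ℂ} {f : ℂ → ℂ}
    (ha : ∀ᶠ z in 𝓝 (0 : ℂ), HasSum (fun k => z ^ k * a k) (f z))
    (hb : ∀ᶠ z in 𝓝 (0 : ℂ), HasSum (fun k => z ^ k * b k) (f z)) : a = b := by
  have key : ∀ c : ℕ → ℂ, (∀ᶠ z in 𝓝 (0 : ℂ), HasSum (fun k => z ^ k * c k) (f z)) →
      HasFPowerSeriesAt f
        (fun k => ContinuousMultilinearMap.mkPiRing ℂ (Fin k) (c k) :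
          FormalMultilinearSeries ℂ ℂ ℂ) 0 := by
    intro c hc
    refine hasFPowerSeriesAt_iff.2 ?_
    simpa [FormalMultilinearSeries.coeff] using hc
  have := (key a ha).eq_formalMultilinearSeries (key b hb)
  ext k
  have h := congrArg (fun p : FormalMultilinearSeries ℂ ℂ ℂ => p.coeff k) this
  simpa [FormalMultilinearSeries.coeff] using h

theorem hasSum_pow_mul_shift {a : ℕ → ℂ} {z s : ℂ} (m : ℕ)
    (h : HasSum (fun k => z ^ k * a k) s) :
    HasSum (fun k => z ^ k * (if m ≤ k then a (k - m) else 0)) (z ^ m * s) := by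
  have h1 := h.mul_left (z ^ m)
  rw [← (add_left_injective m).hasSum_iff]
  · have h2 : ((fun k => z ^ k * (if m ≤ k then a (k - m) else 0)) ∘ fun k => k + m) =
        fun k => z ^ m * (z ^ k * a k) := by
      ext k
      simp only [Function.comp_apply, le_add_iff_nonneg_left, zero_le, if_true,
        Nat.add_sub_cancel]
      ring
    rw [h2]
    exact h1
  · intro k hk
    have : ¬ m ≤ k := fun hmk => hk ⟨k - m, by simp [hmk]⟩
    simp [this]

end JointSpectrum

/-! ### Tangent directions of the surface and moments of `B` -/

section JointSpectrum

open Filter Topology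

variable {H : Type*} [NormedAddCommGroup H] [InnerProductSpace ℂ H]

/-- Used to solve the surface equation for `x` near `x₀`: the base `1 - g t` equals `1` at `t = 0`,
off the cut of the principal power. -/
theorem hasDerivAt_root_of_one_sub {n : ℕ} (hn : n ≠ 0) (x₀ : ℂ) {g : ℂ → ℂ} {g' : ℂ}
    (hg : HasDerivAt g (n * g') 0) (hg0 : g 0 = 0) :
    HasDerivAt (fun t => x₀ * (1 - g t) ^ ((n : ℂ)⁻¹)) (-(x₀ * g')) 0 := by
  have hn' : (n : ℂ) ≠ 0 := Nat.cast_ne_zero.2 hn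
  have h1 : HasDerivAt (fun t => 1 - g t) (-(n * g')) 0 := by simpa using hg.const_sub 1
  have h2 := (h1.cpow_const (c := (n : ℂ)⁻¹) (by simp [hg0])).const_mul x₀
  refine h2.congr_deriv ?_
  simp only [hg0, sub_zero, Complex.one_cpow]
  field_simp

/-- The tangent vectors to the surface `xⁿ + yⁿ + (-1)ⁿ⁻¹ (ω z₁ + z₂)ⁿ = 1` at the point
`(x₀, α, -α x₀, 0)`, where the pencil factors as `(1 - x₀ A) (1 - α B)`. -/
theorem inner_tangent_eq [CompleteSpace H] {A B : H →L[ℂ] H} {n : ℕ} (hn : n ≠ 0) {ω x₀ : ℂ}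
    (hω : ω ^ n = 1) (hx₀ : x₀ ^ n = 1) {ε : ℝ}
    (hsing : ∀ x y z₁ z₂ : ℂ, ‖x - x₀‖ < ε → ‖y‖ < ε → ‖z₁‖ < ε → ‖z₂‖ < ε →
      x ^ n + y ^ n + (-1) ^ (n - 1) * (ω * z₁ + z₂) ^ n = 1 →
      ¬ IsUnit (1 - (x • A + y • B + z₁ • (A * B) + z₂ • (B * A))))
    {e : H} (he : ‖e‖ = 1) (hAe : x₀ • A e = e)
    (hA : ∀ v, inner ℂ e (x₀ • A v) = inner ℂ e v)
    (hunit : IsUnit (1 - x₀ • A + rankOneOperator e)) {α : ℂ} (hαε : ‖α‖ < ε)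
    (hN : IsUnit (1 - α • B)) {u : H} (hu : (1 - α • B) u = e) (a b : ℂ) :
    a * inner ℂ e (B u) + b * inner ℂ e (B (A u)) =
      (α ^ (n - 1) * a + (ω * α * x₀) ^ (n - 1) * b) * inner ℂ e u := by
  have hn1 : ((-1 : ℂ)) ^ (n - 1) * (-1) ^ n = -1 := by
    obtain ⟨m, rfl⟩ := Nat.exists_eq_succ_of_ne_zero hn
    rw [Nat.succ_sub_one, pow_succ, ← mul_assoc, ← mul_pow]
    simp
  have hn2 : ((-1 : ℂ)) ^ (n - 1) * (-1) ^ (n - 1) = 1 := by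
    rw [← mul_pow]
    simp
  have hx₀n : ‖x₀‖ = 1 := Complex.norm_eq_one_of_pow_eq_one hx₀ hn
  have hε : 0 < ε := (norm_nonneg α).trans_lt hαε
  set g' : ℂ := α ^ (n - 1) * a + (ω * α * x₀) ^ (n - 1) * b with hg'
  -- The curve has `y = α + t a`, `z₁ = -α x₀`, `z₂ = t b`. The terms of the surface equation in
  -- `y`, `z₁`, `z₂` cancel at `t = 0`, so their sum is `g t`, and `xⁿ = 1 - g t` keeps the curve on
  -- the surface.
  let g : ℂ → ℂ := fun t => (α + t * a) ^ n - α ^ n +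
    (-1) ^ (n - 1) * ((ω * (-α * x₀) + t * b) ^ n - (ω * (-α * x₀)) ^ n)
  have hg0 : g 0 = 0 := by simp [g]
  have hg : HasDerivAt g (n * g') 0 := by
    have h1 : HasDerivAt (fun t : ℂ => α + t * a) a 0 := by
      simpa using ((hasDerivAt_id (0 : ℂ)).mul_const a).const_add α
    have h2 : HasDerivAt (fun t : ℂ => ω * (-α * x₀) + t * b) b 0 := by
      simpa using ((hasDerivAt_id (0 : ℂ)).mul_const b).const_add (ω * (-α * x₀))
    have h3 := ((h1.fun_pow n).sub_const (α ^ n)).add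
      (((h2.fun_pow n).sub_const ((ω * (-α * x₀)) ^ n)).const_mul ((-1) ^ (n - 1)))
    refine h3.congr_deriv ?_
    simp only [zero_mul, add_zero]
    rw [show ω * (-α * x₀) = (-1) * (ω * α * x₀) by ring, mul_pow (-1), hg']
    linear_combination (n * (ω * α * x₀) ^ (n - 1) * b) * hn2
  let x : ℂ → ℂ := fun t => x₀ * (1 - g t) ^ ((n : ℂ)⁻¹)
  have hx : HasDerivAt x (-(x₀ * g')) 0 := hasDerivAt_root_of_one_sub hn x₀ hg hg0
  have hx0 : x 0 = x₀ := by simp [x, hg0]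
  have hxn : ∀ t, x t ^ n = 1 - g t := by
    intro t
    simp only [x]
    rw [mul_pow, hx₀, one_mul, Complex.cpow_nat_inv_pow _ hn]
  have hslope : Tendsto (fun t => t⁻¹ * (x t - x₀)) (𝓝[≠] 0) (𝓝 (-(x₀ * g'))) := by
    have := hx.tendsto_slope_zero
    simpa [hx0] using this
  -- Along the curve the pencil is `(1 - x₀ A)(1 - α B) - t T(t)`, with `T(t)` tending to the `D`
  -- given here.
  have hkey := inner_apply_eq_zero_of_tendsto (l := 𝓝[≠] (0 : ℂ)) (G := 1 - x₀ • A)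
    (N := 1 - α • B) (D := (-(x₀ * g')) • A + a • B + b • (B * A)) (s := fun t => t)
    (T := fun t => (t⁻¹ * (x t - x₀)) • A + a • B + b • (B * A)) he (by simp [hAe])
    (fun v => by
      rw [sub_apply, inner_sub_right, smul_apply, hA]
      simp)
    hunit hN hu (tendsto_id.mono_left nhdsWithin_le_nhds) self_mem_nhdsWithin
    (((hslope.smul_const A).add_const _).add_const _) ?_
  · simp only [add_apply, smul_apply, mul_apply_eq_comp, inner_add_right, inner_smul_right] at hkey
    have h2 := hA u
    rw [inner_smul_right] at h2
    linear_combination hkey + g' * h2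
  · have c1 : ∀ᶠ t in 𝓝[≠] (0 : ℂ), ‖x t - x₀‖ < ε := by
      have : Tendsto (fun t => ‖x t - x₀‖) (𝓝 0) (𝓝 0) := by
        have := (hx.continuousAt.tendsto.sub_const x₀).norm
        simpa [hx0] using this
      exact (this.mono_left nhdsWithin_le_nhds).eventually (gt_mem_nhds hε)
    have c2 : ∀ᶠ t in 𝓝[≠] (0 : ℂ), ‖α + t * a‖ < ε := by
      have : Continuous fun t : ℂ => ‖α + t * a‖ := by fun_prop
      have := this.tendsto 0
      simp only [zero_mul, add_zero] at this
      exact (this.mono_left nhdsWithin_le_nhds).eventually (gt_mem_nhds hαε)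
    have c3 : ∀ᶠ t in 𝓝[≠] (0 : ℂ), ‖t * b‖ < ε := by
      have : Continuous fun t : ℂ => ‖t * b‖ := by fun_prop
      have := this.tendsto 0
      simp only [zero_mul, norm_zero] at this
      exact (this.mono_left nhdsWithin_le_nhds).eventually (gt_mem_nhds hε)
    filter_upwards [c1, c2, c3, self_mem_nhdsWithin] with t h1 h2 h3 ht
    have ht0 : t ≠ 0 := ht
    have hns := hsing (x t) (α + t * a) (-α * x₀) (t * b) h1 h2 (by simpa [hx₀n] using hαε) h3 (by
      rw [hxn]
      simp only [g]
      rw [show ω * (-α * x₀) = (-1) * (ω * α * x₀) by ring, mul_pow (-1), mul_pow, mul_pow, hx₀,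
        hω]
      linear_combination (α ^ n) * hn1)
    convert hns using 2
    have h4 : t • ((t⁻¹ * (x t - x₀)) • A) = (x t - x₀) • A := by
      rw [smul_smul, mul_inv_cancel_left₀ ht0]
    rw [smul_add, smul_add, h4]
    simp only [sub_mul, mul_sub, one_mul, mul_one, smul_mul_assoc, mul_smul_comm, smul_smul,
      sub_smul, add_smul, neg_mul, neg_smul, smul_sub]
    abel

theorem hasSum_pow_smul_apply_inverse [CompleteSpace H] {B : H →L[ℂ] H} {α : ℂ}
    (h : ‖α • B‖ < 1) (e : H) :
    IsUnit (1 - α • B) ∧ ∃ u : H, (1 - α • B) u = e ∧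
      ∀ φ : H →L[ℂ] ℂ, HasSum (fun k => α ^ k * φ ((B ^ k) e)) (φ u) := by
  have hs : Summable fun k => (α • B) ^ k := summable_geometric_of_norm_lt_one h
  have h1 := mul_neg_geom_series (α • B) h
  have h2 := geom_series_mul_neg (α • B) h
  refine ⟨⟨⟨_, _, h1, h2⟩, rfl⟩, (∑' k, (α • B) ^ k) e, ?_, fun φ => ?_⟩
  · rw [← mul_apply_eq_comp, h1]
    simp
  · have := (φ.comp (ContinuousLinearMap.apply ℂ H e)).hasSum hs.hasSum
    simpa [smul_pow] using this

/-- Put `u = (1 - α B)⁻¹ e` and `F(α) = ⟨e, u⟩`. The direction `(a, b) = (1, 0)` gives `⟨e, B u⟩ =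
αⁿ⁻¹ F`, hence `F = 1 + αⁿ F`; its coefficient at `αⁿ` is the first identity. The direction `(0, 1)`
gives `⟨e, B A u⟩ = (ω α x₀)ⁿ⁻¹ F`; its coefficient at `αⁿ⁻¹` is the second. -/
theorem inner_pow_apply_eq [CompleteSpace H] {A B : H →L[ℂ] H} {n : ℕ} (hn : n ≠ 0) {ω x₀ : ℂ}
    (hω : ω ^ n = 1) (hx₀ : x₀ ^ n = 1) {ε : ℝ} (hε : 0 < ε)
    (hsing : ∀ x y z₁ z₂ : ℂ, ‖x - x₀‖ < ε → ‖y‖ < ε → ‖z₁‖ < ε → ‖z₂‖ < ε →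
      x ^ n + y ^ n + (-1) ^ (n - 1) * (ω * z₁ + z₂) ^ n = 1 →
      ¬ IsUnit (1 - (x • A + y • B + z₁ • (A * B) + z₂ • (B * A))))
    {e : H} (he : ‖e‖ = 1) (hAe : x₀ • A e = e)
    (hA : ∀ v, inner ℂ e (x₀ • A v) = inner ℂ e v)
    (hunit : IsUnit (1 - x₀ • A + rankOneOperator e)) :
    inner ℂ e ((B ^ n) e) = (1 : ℂ) ∧
      inner ℂ e (B (A ((B ^ (n - 1)) e))) = (ω * x₀) ^ (n - 1) := by
  have hee : inner ℂ e e = (1 : ℂ) := by rw [inner_self_eq_norm_sq_to_K, he]; simp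
  have hsmall : ∀ᶠ α in 𝓝 (0 : ℂ), ‖α‖ < ε ∧ ‖α • B‖ < 1 := by
    have h1 : Continuous fun α : ℂ => ‖α • B‖ := by fun_prop
    have h2 := h1.tendsto 0
    simp only [zero_smul, norm_zero] at h2
    have h3 := (continuous_norm (E := ℂ)).tendsto 0
    simp only [norm_zero] at h3
    exact (h3.eventually (gt_mem_nhds hε)).and (h2.eventually (gt_mem_nhds one_pos))
  let u : ℂ → H := fun α => Ring.inverse (1 - α • B) e
  have hdata : ∀ᶠ α in 𝓝 (0 : ℂ), (1 - α • B) (u α) = e ∧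
      (∀ φ : H →L[ℂ] ℂ, HasSum (fun k => α ^ k * φ ((B ^ k) e)) (φ (u α))) ∧
      inner ℂ e (B (u α)) = α ^ (n - 1) * inner ℂ e (u α) ∧
      inner ℂ e (B (A (u α))) = (ω * α * x₀) ^ (n - 1) * inner ℂ e (u α) := by
    filter_upwards [hsmall] with α hα
    obtain ⟨hunitN, v, hv, hsum⟩ := hasSum_pow_smul_apply_inverse hα.2 e
    have huv : u α = v := by
      simp only [u]
      rw [← hv, ← mul_apply_eq_comp, Ring.inverse_mul_cancel _ hunitN]
      simp
    rw [huv]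
    have := inner_tangent_eq hn hω hx₀ hsing he hAe hA hunit hα.1 hunitN hv
    exact ⟨hv, hsum, by simpa using this 1 0, by simpa using this 0 1⟩
  let p : ℕ → ℂ := fun k => inner ℂ e ((B ^ k) e)
  have hp : ∀ᶠ α in 𝓝 (0 : ℂ), HasSum (fun k => α ^ k * p k) (inner ℂ e (u α)) :=
    hdata.mono fun α hα => hα.2.1 (innerSL ℂ e)
  have hp0 : p 0 = 1 := by simp [p, he]
  have h1 : p = fun k => (if k = 0 then 1 else 0) + (if n ≤ k then p (k - n) else 0) := by
    refine eq_of_hasSum_pow_mul hp ?_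
    filter_upwards [hp, hdata] with α hα hd
    have h2 : HasSum (fun k => α ^ k * (if k = 0 then (1 : ℂ) else 0)) 1 := by
      convert hasSum_ite_eq (0 : ℕ) (1 : ℂ) using 2 with k
      split_ifs with hk <;> simp [hk]
    have h3 := h2.add (hasSum_pow_mul_shift n hα)
    have h4 : inner ℂ e (u α) = 1 + α ^ n * inner ℂ e (u α) := by
      have h5 := congrArg (inner ℂ e) hd.1
      simp only [sub_apply, one_apply_eq_self, smul_apply, inner_sub_right, inner_smul_right, hee,
        hd.2.2.1] at h5
      have h6 : α ^ n = α * α ^ (n - 1) := by rw [mul_comm, pow_sub_one_mul hn]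
      rw [h6]
      linear_combination h5
    rw [h4]
    simpa [mul_add] using h3
  refine ⟨?_, ?_⟩
  · have h2 := congrFun h1 n
    have h3 : p n = 1 := by simpa [hn, hp0] using h2
    exact h3
  · have h2 : (fun k => inner ℂ e (B (A ((B ^ k) e)))) =
        fun k => (ω * x₀) ^ (n - 1) * (if n - 1 ≤ k then p (k - (n - 1)) else 0) := by
      refine eq_of_hasSum_pow_mul (f := fun α => inner ℂ e (B (A (u α)))) ?_ ?_
      · exact hdata.mono fun α hα => hα.2.1 ((innerSL ℂ e).comp (B * A))
      · filter_upwards [hp, hdata] with α hα hd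
        have h3 := (hasSum_pow_mul_shift (n - 1) hα).mul_left ((ω * x₀) ^ (n - 1))
        rw [hd.2.2.2, mul_right_comm, mul_pow _ α, mul_assoc]
        simpa only [mul_left_comm] using h3
    have h3 := congrFun h2 (n - 1)
    simpa [hp0] using h3

end JointSpectrum

/-! ### Eigenbases of the clock and shift pair -/

section EigenbasesOfClockAndShift

theorem rootOfUnity_isPrimitiveRoot {n : ℕ} (hn : n ≠ 0) : IsPrimitiveRoot (rootOfUnity n) n :=
  Complex.isPrimitiveRoot_exp n hn

theorem norm_rootOfUnity {n : ℕ} (hn : n ≠ 0) : ‖rootOfUnity n‖ = 1 :=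
  Complex.norm_eq_one_of_pow_eq_one (rootOfUnity_isPrimitiveRoot hn).pow_eq_one hn

theorem Orthonormal.exists_orthonormalBasis_coe_eq {V : Type*} [NormedAddCommGroup V]
    [InnerProductSpace ℂ V] {n : ℕ} [FiniteDimensional ℂ V] {v : Fin n → V}
    (hv : Orthonormal ℂ v) (hn : Module.finrank ℂ V = n) :
    ∃ b : OrthonormalBasis (Fin n) ℂ V, ⇑b = v :=
  ⟨OrthonormalBasis.mk hv
    (hv.linearIndependent.span_eq_top_of_card_eq_finrank' (by simp [hn])).ge, by simp⟩

variable {V : Type*} [NormedAddCommGroup V] [InnerProductSpace ℂ V] {n : ℕ}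

theorem OrthonormalBasis.repr_map_of_eigenvectors (b : OrthonormalBasis (Fin n) ℂ V)
    {T : V →ₗ[ℂ] V} {c : Fin n → ℂ} (h : ∀ j, T (b j) = c j • b j) (v : V) (j : Fin n) :
    b.repr (T v) j = c j * b.repr v j := by
  conv_lhs => rw [← b.sum_repr v]
  simp [map_sum, h, Pi.single_apply, mul_comm]

theorem sum_pow_eq_zero_of_pow_eq_one {r : ℂ} (hr : r ^ n = 1) (hr1 : r ≠ 1) :
    ∑ k : Fin n, r ^ (k : ℕ) = 0 := by
  rw [Fin.sum_univ_eq_sum_range (fun k => r ^ k)]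
  have := geom_sum_mul r n
  rw [hr, sub_self] at this
  exact (mul_eq_zero.1 this).resolve_right (sub_ne_zero.2 hr1)

variable {S T : V →ₗ[ℂ] V} (f : OrthonormalBasis (Fin n) ℂ V)

theorem pairUnitarilyEquivalent_of_clock_shift
    (hS : ∀ k : Fin n, S (f k) = rootOfUnity n ^ (k : ℕ) • f k)
    (hT : ∀ k l : Fin n, (l : ℕ) = ((k : ℕ) + 1) % n → T (f k) = f l) :
    PairUnitarilyEquivalent S T (clockMatrix n) (shiftMatrix n) := by
  have key : ∀ (R : V →ₗ[ℂ] V) (M : Matrix (Fin n) (Fin n) ℂ),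
      (∀ j k, f.repr (R (f k)) j = M j k) →
        ∀ v, f.repr (R v) = Matrix.toEuclideanLin M (f.repr v) := by
    intro R M h v
    ext j
    conv_lhs => rw [← f.sum_repr v]
    simp [map_sum, h, Matrix.toLpLin_apply, Matrix.mulVec, dotProduct,
      mul_comm]
  refine ⟨f.repr, key S _ fun j k => ?_, key T _ fun j k => ?_⟩
  · rw [hS]
    by_cases h : j = k
    · subst h
      simp [clockMatrix]
    · simp [clockMatrix, h]
  · have hpos : 0 < n := Fin.pos k
    rw [hT k ⟨((k : ℕ) + 1) % n, Nat.mod_lt _ hpos⟩ rfl]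
    simp [shiftMatrix, Fin.ext_iff]

/-- The discrete Fourier transform `∑ₖ ω⁻ᵐᵏ fₖ`, divided by `√n`, diagonalizes the cyclic shift. -/
theorem exists_isRootOfUnityEigenbasis_of_shift [FiniteDimensional ℂ V] (hn : n ≠ 0)
    (hT : ∀ k l : Fin n, (l : ℕ) = ((k : ℕ) + 1) % n → T (f k) = f l) :
    ∃ ζ : OrthonormalBasis (Fin n) ℂ V, IsRootOfUnityEigenbasis T ζ := by
  have : NeZero n := ⟨hn⟩
  have hω := rootOfUnity_isPrimitiveRoot hn
  have hωn := hω.pow_eq_one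
  set ω := rootOfUnity n with hωdef
  have hω0 : ω ≠ 0 := hω.ne_zero hn
  let q : Fin n → ℂ := fun m => (ω ^ (m : ℕ))⁻¹
  have hq : ∀ m, q m ^ n = 1 := by
    intro m
    simp only [q]
    rw [inv_pow, pow_right_comm, hωn, one_pow, inv_one]
  let z : Fin n → V := fun m => ∑ k : Fin n, q m ^ (k : ℕ) • f k
  have hTz : ∀ m, T (z m) = ω ^ (m : ℕ) • z m := by
    intro m
    have h1 : ∀ k : Fin n, T (f k) = f (k + 1) := fun k => hT _ _ (by simp [Fin.val_add])
    -- Addition in `Fin n` wraps around at `k = n - 1`; this is harmless because `q m ^ n = 1`.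
    have h2 : ∀ k : Fin n, q m ^ (k : ℕ) = ω ^ (m : ℕ) * q m ^ ((k + 1 : Fin n) : ℕ) := by
      intro k
      have h3 : q m ^ ((k + 1 : Fin n) : ℕ) = q m ^ ((k : ℕ) + 1) := by
        rw [Fin.val_add, ← pow_eq_pow_mod _ (hq m), pow_add, pow_add]
        congr 1
        rw [Fin.val_one', ← pow_eq_pow_mod _ (hq m)]
      rw [h3, pow_succ']
      simp only [q]
      rw [mul_inv_cancel_left₀ (pow_ne_zero _ hω0)]
    simp only [z, map_sum, map_smul, h1, Finset.smul_sum, smul_smul]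
    rw [← Equiv.sum_comp (Equiv.addRight (1 : Fin n))
      (fun k : Fin n => (ω ^ (m : ℕ) * q m ^ (k : ℕ)) • f k)]
    exact Finset.sum_congr rfl fun k _ => by rw [h2 k]; rfl
  have hzz : ∀ m l, inner ℂ (z m) (z l) = if m = l then (n : ℂ) else 0 := by
    intro m l
    have hconj : (starRingEnd ℂ) (q m) = ω ^ (m : ℕ) := by
      simp only [q]
      rw [map_inv₀, map_pow, ← Complex.inv_eq_conj (norm_rootOfUnity hn), inv_pow, inv_inv]
    simp only [z]
    rw [f.orthonormal.inner_sum]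
    have h1 : ∀ k : Fin n, (starRingEnd ℂ) (q m ^ (k : ℕ)) * q l ^ (k : ℕ) =
        (ω ^ (m : ℕ) * q l) ^ (k : ℕ) := by
      intro k
      rw [map_pow, hconj, mul_pow]
    simp only [h1]
    split_ifs with h
    · subst h
      simp [q, hω0]
    · refine sum_pow_eq_zero_of_pow_eq_one ?_ ?_
      · rw [mul_pow, hq, pow_right_comm, hωn, one_pow, one_mul]
      · intro h2
        simp only [q] at h2
        rw [mul_inv_eq_one₀ (pow_ne_zero _ hω0)] at h2
        exact h (Fin.ext (hω.pow_inj m.2 l.2 h2))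
  have hsq : (Real.sqrt n : ℂ) * Real.sqrt n = n := by
    rw [← Complex.ofReal_mul, Real.mul_self_sqrt n.cast_nonneg]
    simp
  have hs0 : (Real.sqrt n : ℂ) ≠ 0 := by
    intro h
    rw [h, zero_mul] at hsq
    exact hn (by exact_mod_cast hsq.symm)
  have hon : Orthonormal ℂ fun m => (Real.sqrt n : ℂ)⁻¹ • z m := by
    rw [orthonormal_iff_ite]
    intro m l
    rw [inner_smul_left, inner_smul_right, hzz, map_inv₀, Complex.conj_ofReal]
    split_ifs with h
    · rw [← hsq]
      field_simp
    · simp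
  obtain ⟨ζ, hζ⟩ := hon.exists_orthonormalBasis_coe_eq
    (by simpa using Module.finrank_eq_card_basis f.toBasis)
  refine ⟨ζ, fun j => ?_⟩
  rw [hζ]
  simp only [map_smul, hTz]
  rw [smul_comm]

/-- The eigenvalues of `S` are distinct, so `eₖ` is a unimodular multiple of `fₖ`. As `fₖ = Tᵏ f₀`,
its `j`-th coordinate in `ζ` is `ωʲᵏ dⱼ`, and Parseval for `ζⱼ` in the basis `f` gives `n |dⱼ|² =
1`. -/
theorem transitionMatrix_eq_of_clock_shift (hn : n ≠ 0)
    (hS : ∀ k : Fin n, S (f k) = rootOfUnity n ^ (k : ℕ) • f k)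
    (hT : ∀ k l : Fin n, (l : ℕ) = ((k : ℕ) + 1) % n → T (f k) = f l)
    {e ζ : OrthonormalBasis (Fin n) ℂ V} (he : IsRootOfUnityEigenbasis S e)
    (hζ : IsRootOfUnityEigenbasis T ζ) :
    ∃ a b : Fin n → ℂ, (∀ j, ‖a j‖ = 1) ∧ (∀ j, ‖b j‖ = 1) ∧
      (Real.sqrt n : ℂ) • transitionMatrix e ζ =
        Matrix.diagonal a * fourierMatrix n * Matrix.diagonal b := by
  have hω := rootOfUnity_isPrimitiveRoot hn
  have hpos : 0 < n := Nat.pos_of_ne_zero hn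
  have hef : ∀ k, e k = f.repr (e k) k • f k := by
    intro k
    have h0 : ∀ j, j ≠ k → f.repr (e k) j = 0 := by
      intro j hj
      have h1 := f.repr_map_of_eigenvectors hS (e k) j
      rw [he k, map_smul, PiLp.smul_apply, smul_eq_mul] at h1
      by_contra h2
      exact hj (Fin.ext (hω.pow_inj j.2 k.2 (mul_right_cancel₀ h2 h1.symm)))
    conv_lhs => rw [← f.sum_repr (e k)]
    exact Finset.sum_eq_single k (fun j _ hj => by rw [h0 j hj, zero_smul]) (by simp)
  have hb : ∀ k, ‖f.repr (e k) k‖ = 1 := by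
    intro k
    have := congrArg norm (hef k)
    rw [norm_smul, e.orthonormal.1, f.orthonormal.1, mul_one] at this
    exact this.symm
  let d : Fin n → ℂ := fun j => ζ.repr (f ⟨0, hpos⟩) j
  have hζf : ∀ (k : ℕ) (hk : k < n) (j : Fin n),
      ζ.repr (f ⟨k, hk⟩) j = rootOfUnity n ^ ((j : ℕ) * k) * d j := by
    intro k
    induction k with
    | zero => intro hk j; simp [d]
    | succ k ih =>
      intro hk j
      have hk' : k < n := by omega
      rw [← hT ⟨k, hk'⟩ ⟨k + 1, hk⟩ (by simp [Nat.mod_eq_of_lt hk]),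
        ζ.repr_map_of_eigenvectors hζ, ih hk' j, mul_add, mul_one, pow_add]
      ring
  have hd : ∀ j, ‖(Real.sqrt n : ℂ) * d j‖ = 1 := by
    intro j
    have h1 := f.sum_sq_norm_inner_left (ζ j)
    have h2 : ∀ k : Fin n, ‖inner ℂ (ζ j) (f k)‖ = ‖d j‖ := by
      intro k
      rw [← ζ.repr_apply_apply, hζf k k.2 j, norm_mul, norm_pow, norm_rootOfUnity hn, one_pow,
        one_mul]
    simp only [h2, ζ.orthonormal.1, Finset.sum_const, Finset.card_univ, Fintype.card_fin,
      nsmul_eq_mul, one_pow] at h1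
    have h3 : (Real.sqrt n * ‖d j‖) ^ 2 = 1 := by
      rw [mul_pow, Real.sq_sqrt n.cast_nonneg, h1]
    rw [norm_mul, Complex.norm_real, Real.norm_of_nonneg (Real.sqrt_nonneg _)]
    exact (pow_eq_one_iff_of_nonneg (by positivity) two_ne_zero).1 h3
  refine ⟨fun j => (Real.sqrt n : ℂ) * d j, fun k => f.repr (e k) k, hd, hb, ?_⟩
  ext j k
  rw [Matrix.mul_diagonal, Matrix.diagonal_mul, Matrix.smul_apply, transitionMatrix,
    fourierMatrix, Matrix.of_apply, Matrix.of_apply, smul_eq_mul]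
  conv_lhs => rw [hef k]
  rw [map_smul, PiLp.smul_apply, smul_eq_mul, hζf k k.2 j]
  ring

end EigenbasesOfClockAndShift

/-! ### From moments to a cyclic family of eigenvectors -/

section ClockAndShiftPairs

open Polynomial

variable {H : Type*} [NormedAddCommGroup H] [InnerProductSpace ℂ H]

/-- The factors `X - c` are pairwise coprime, so the kernel of the product is the sum of the
eigenspaces, each at most a line. -/
theorem rank_ker_aeval_prod_X_sub_C_le {V : Type*} [AddCommGroup V] [Module ℂ V]
    (f : Module.End ℂ V) (s : Finset ℂ)
    (h : ∀ c ∈ s, ∀ v w : V, v ≠ 0 → f v = c • v → f w = c • w → ∃ d : ℂ, w = d • v) :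
    Module.rank ℂ (LinearMap.ker (aeval f (∏ c ∈ s, (X - C c)))) ≤ s.card := by
  classical
  induction s using Finset.induction_on with
  | empty =>
    rw [Finset.prod_empty, map_one, Module.End.one_eq_id, LinearMap.ker_id]
    simp
  | insert c s hc ih =>
    have hcop : IsCoprime (X - C c) (∏ c ∈ s, (X - C c)) := by
      refine IsCoprime.prod_right fun d hd => isCoprime_X_sub_C_of_isUnit_sub ?_
      refine (sub_ne_zero.2 ?_).isUnit
      rintro rfl
      exact hc hd
    rw [Finset.prod_insert hc, ← sup_ker_aeval_eq_ker_aeval_mul_of_coprime f hcop,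
      Finset.card_insert_of_notMem hc, Nat.cast_add, Nat.cast_one, add_comm]
    refine (Submodule.rank_add_le_rank_add_rank _ _).trans (add_le_add ?_
      (ih fun d hd => h d (Finset.mem_insert_of_mem hd)))
    have hmem : ∀ v, v ∈ LinearMap.ker (aeval f (X - C c)) → f v = c • v := by
      intro v hv
      simpa [sub_eq_zero, Module.algebraMap_end_apply] using hv
    rw [rank_submodule_le_one_iff']
    by_cases h0 : ∃ v ∈ LinearMap.ker (aeval f (X - C c)), v ≠ 0
    · obtain ⟨v, hv, hv0⟩ := h0
      refine ⟨v, fun w hw => ?_⟩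
      obtain ⟨d, hd⟩ := h c (Finset.mem_insert_self _ _) v w hv0 (hmem v hv) (hmem w hw)
      exact Submodule.mem_span_singleton.2 ⟨d, hd.symm⟩
    · push Not at h0
      exact ⟨0, fun w hw => by rw [h0 w hw]; exact zero_mem _⟩

theorem rank_ker_aeval_X_pow_sub_one_le {V : Type*} [AddCommGroup V] [Module ℂ V]
    (f : Module.End ℂ V) {n : ℕ} (hn : 0 < n)
    (h : ∀ c : ℂ, c ^ n = 1 → ∀ v w : V, v ≠ 0 → f v = c • v → f w = c • w → ∃ d : ℂ, w = d • v) :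
    Module.rank ℂ (LinearMap.ker (aeval f (X ^ n - 1 : ℂ[X]))) ≤ n := by
  have hω := Complex.isPrimitiveRoot_exp n hn.ne'
  have h1 := rank_ker_aeval_prod_X_sub_C_le f (nthRootsFinset n (1 : ℂ))
    fun c hc => h c ((mem_nthRootsFinset hn 1).1 hc)
  rwa [← X_pow_sub_one_eq_prod hn hω, hω.card_nthRootsFinset] at h1

/-- Equality in Cauchy–Schwarz: `‖v - e‖² = ‖v‖² - 2 + 1 ≤ 0`. -/
theorem eq_of_inner_eq_one {e v : H} (he : ‖e‖ = 1) (hv : ‖v‖ ≤ 1)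
    (h : inner ℂ e v = (1 : ℂ)) : v = e := by
  have h1 := norm_sub_sq (𝕜 := ℂ) v e
  have h2 : inner ℂ v e = (1 : ℂ) := by rw [← inner_conj_symm, h, map_one]
  rw [h2, he] at h1
  simp only [RCLike.one_re] at h1
  have h3 : ‖v - e‖ = 0 := by nlinarith [norm_nonneg v, norm_nonneg (v - e)]
  exact sub_eq_zero.1 (norm_eq_zero.1 h3)

/-- For normal `S`, the operators `1 - S` and its adjoint have the same kernel. -/
theorem IsStarNormal.inner_apply_of_apply_eq [CompleteSpace H] {S : H →L[ℂ] H}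
    (hS : IsStarNormal S) {e : H} (he : S e = e) (v : H) :
    inner ℂ e (S v) = inner ℂ e v := by
  have h1 : IsStarNormal (1 - S) := inferInstance
  have h2 := (ContinuousLinearMap.IsStarNormal.adjoint_apply_eq_zero_iff h1 e).2 (by simp [he])
  have h3 : inner ℂ e ((1 - S) v) = 0 := by
    rw [← ContinuousLinearMap.adjoint_inner_left, h2, inner_zero_left]
  simp only [sub_apply, one_apply_eq_self, inner_sub_right] at h3
  exact (sub_eq_zero.1 h3).symm

theorem IsStarNormal.orthonormal_of_eigenvectors [CompleteSpace H] {A : H →L[ℂ] H}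
    (hA : IsStarNormal A) {ι : Type*} {f : ι → H} {c : ι → ℂ} (hc0 : ∀ i, c i ≠ 0)
    (hc : Function.Injective c) (hf1 : ∀ i, ‖f i‖ = 1) (hf : ∀ i, c i • A (f i) = f i) :
    Orthonormal ℂ f := by
  refine ⟨hf1, fun i j hij => ?_⟩
  have h1 := (inferInstance : IsStarNormal (c i • A)).inner_apply_of_apply_eq (e := f i)
    (hf i) (f j)
  have h2 : A (f j) = (c j)⁻¹ • f j := by
    rw [eq_inv_smul_iff₀ (hc0 j), hf j]
  rw [smul_apply, h2, smul_smul, inner_smul_right] at h1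
  by_contra h3
  have h4 : c i * (c j)⁻¹ = 1 := by
    refine mul_right_cancel₀ h3 ?_
    rw [h1, one_mul]
  rw [mul_inv_eq_one₀ (hc0 j)] at h4
  exact hij (hc h4)

/-- If `e` is a unit eigenvector of `A` with `⟨e, Bⁿ e⟩ = 1`, then `Bⁿ⁻¹ e` is mapped to `e` by the
contraction `B`, and `⟨e, B A Bⁿ⁻¹ e⟩` is the mean value of `A` at `Bⁿ⁻¹ e`. -/
theorem pow_sub_one_apply_properties [CompleteSpace H] {A B : H →L[ℂ] H} (hB : ‖B‖ ≤ 1) {n : ℕ}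
    (hn : n ≠ 0) {e : H} (he : ‖e‖ = 1) (h : inner ℂ e ((B ^ n) e) = (1 : ℂ)) :
    (B ^ n) e = e ∧ B ((B ^ (n - 1)) e) = e ∧ ‖(B ^ (n - 1)) e‖ = 1 ∧
      inner ℂ e (B (A ((B ^ (n - 1)) e))) =
        inner ℂ ((B ^ (n - 1)) e) (A ((B ^ (n - 1)) e)) := by
  have hpow : ∀ k, ‖(B ^ k) e‖ ≤ 1 := by
    intro k
    calc ‖(B ^ k) e‖ ≤ ‖B ^ k‖ * ‖e‖ := (B ^ k).le_opNorm e
      _ ≤ 1 := by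
        rw [he, mul_one]
        rcases Nat.eq_zero_or_pos k with rfl | hk
        · exact ContinuousLinearMap.norm_id_le
        · exact (norm_pow_le' B hk).trans (pow_le_one₀ (norm_nonneg _) hB)
  have h1 : (B ^ n) e = e := eq_of_inner_eq_one he (hpow n) h
  have h2 : B ((B ^ (n - 1)) e) = e := by
    rw [← mul_apply_eq_comp, mul_pow_sub_one hn, h1]
  have h3 : ‖(B ^ (n - 1)) e‖ = 1 := by
    refine le_antisymm (hpow _) ?_
    calc (1 : ℝ) = ‖B ((B ^ (n - 1)) e)‖ := by rw [h2, he]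
      _ ≤ ‖B‖ * ‖(B ^ (n - 1)) e‖ := B.le_opNorm _
      _ ≤ ‖(B ^ (n - 1)) e‖ := mul_le_of_le_one_left (norm_nonneg _) hB
  refine ⟨h1, h2, h3, ?_⟩
  -- `B* e` has norm at most one and inner product one with the unit vector `Bⁿ⁻¹ e`.
  have h4 : ContinuousLinearMap.adjoint B e = (B ^ (n - 1)) e := by
    refine eq_of_inner_eq_one h3 ?_ ?_
    · calc ‖ContinuousLinearMap.adjoint B e‖ ≤ ‖ContinuousLinearMap.adjoint B‖ * ‖e‖ :=
            ContinuousLinearMap.le_opNorm _ _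
        _ ≤ 1 := by
          rw [he, mul_one, LinearIsometryEquiv.norm_map]
          exact hB
    · rw [ContinuousLinearMap.adjoint_inner_right, h2, inner_self_eq_norm_sq_to_K, he]
      simp
  rw [← ContinuousLinearMap.adjoint_inner_left, h4]

/-- The cyclic basis `g, B g, …, Bⁿ⁻¹ g` of eigenvectors of `A`. -/
theorem exists_cyclic_eigenvectors [CompleteSpace H] {A B : H →L[ℂ] H} (hA : IsStarNormal A)
    (hB : ‖B‖ ≤ 1) {n : ℕ} (hn : n ≠ 0) {ω : ℂ} (hω : IsPrimitiveRoot ω n)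
    (hex : ∀ x : ℂ, x ^ n = 1 → ∃ e : H, ‖e‖ = 1 ∧ x • A e = e)
    (hinner : ∀ x : ℂ, x ^ n = 1 → ∀ e : H, ‖e‖ = 1 → x • A e = e →
      inner ℂ e ((B ^ n) e) = (1 : ℂ) ∧
        inner ℂ e (B (A ((B ^ (n - 1)) e))) = (ω * x) ^ (n - 1))
    (hsimple : ∀ c : ℂ, c ^ n = 1 → ∀ v w : H, v ≠ 0 → B v = c • v → B w = c • w →
      ∃ d : ℂ, w = d • v) :
    ∃ g : H, (B ^ n) g = g ∧
      ∀ k < n, ‖(B ^ k) g‖ = 1 ∧ A ((B ^ k) g) = ω ^ k • (B ^ k) g := by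
  have hω0 : ω ≠ 0 := hω.ne_zero hn
  have hωn := hω.pow_eq_one
  let L : Submodule ℂ H := LinearMap.ker (aeval B.toLinearMap (X ^ n - 1 : ℂ[X]))
  have hpowlin : ∀ (k : ℕ) (v : H), (B.toLinearMap ^ k) v = (B ^ k) v := by
    intro k v
    induction k with
    | zero => rfl
    | succ k ih => rw [pow_succ', pow_succ', Module.End.mul_apply, ih]; rfl
  have hL : ∀ v, v ∈ L ↔ (B ^ n) v = v := by
    intro v
    simp only [L, LinearMap.mem_ker, map_sub, map_pow, aeval_X, map_one, LinearMap.sub_apply,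
      Module.End.one_apply, hpowlin, sub_eq_zero]
  have hrank : Module.rank ℂ L ≤ n :=
    rank_ker_aeval_X_pow_sub_one_le B.toLinearMap (Nat.pos_of_ne_zero hn) hsimple
  have : FiniteDimensional ℂ L :=
    Module.rank_lt_aleph0_iff.1 (hrank.trans_lt Cardinal.natCast_lt_aleph0)
  have hfin : Module.finrank ℂ L ≤ n := Module.finrank_le_of_rank_le hrank
  have hroot : ∀ j : ℕ, (ω ^ j) ^ n = 1 := fun j => by rw [pow_right_comm, hωn, one_pow]
  choose e he1 heA using fun j : Fin n => hex (ω ^ (j : ℕ)) (hroot j)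
  have heon : Orthonormal ℂ e := hA.orthonormal_of_eigenvectors (fun j => pow_ne_zero _ hω0)
    (fun i j hij => Fin.ext (hω.pow_inj i.2 j.2 hij)) he1 heA
  have heL : ∀ j, e j ∈ L := fun j => (hL _).2
    (pow_sub_one_apply_properties (A := A) hB hn (he1 j)
      (hinner _ (hroot j) _ (he1 j) (heA j)).1).1
  -- The `n` orthonormal eigenvectors of `A` lie in `L`, whose dimension is at most `n`.
  have hspan : Submodule.span ℂ (Set.range e) = L := by
    refine Submodule.eq_of_le_of_finrank_le (Submodule.span_le.2 ?_) ?_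
    · rintro _ ⟨j, rfl⟩
      exact heL j
    · rw [finrank_span_eq_card heon.linearIndependent]
      simpa using hfin
  -- `A` is diagonal with unimodular entries in an orthonormal basis of `L`. This supplies the norm
  -- bound for the equality case of Cauchy–Schwarz at `Bⁿ⁻¹ e`.
  have hiso : ∀ v ∈ L, ‖A v‖ = ‖v‖ := by
    intro v hv
    rw [← hspan, Submodule.mem_span_range_iff_exists_fun] at hv
    obtain ⟨c, rfl⟩ := hv
    have h1 : A (∑ i, c i • e i) = ∑ i, (c i * (ω ^ (i : ℕ))⁻¹) • e i := by
      rw [map_sum]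
      refine Finset.sum_congr rfl fun i _ => ?_
      rw [map_smul, mul_smul]
      congr 1
      rw [eq_inv_smul_iff₀ (pow_ne_zero _ hω0), heA]
    have hnω : ‖ω‖ = 1 := Complex.norm_eq_one_of_pow_eq_one hωn hn
    have h2 : inner ℂ (A (∑ i, c i • e i)) (A (∑ i, c i • e i)) =
        inner ℂ (∑ i, c i • e i) (∑ i, c i • e i) := by
      rw [h1, heon.inner_sum, heon.inner_sum]
      refine Finset.sum_congr rfl fun i _ => ?_
      rw [← Complex.normSq_eq_conj_mul_self, ← Complex.normSq_eq_conj_mul_self,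
        Complex.normSq_eq_norm_sq, Complex.normSq_eq_norm_sq, norm_mul, norm_inv, norm_pow, hnω]
      simp
    rw [inner_self_eq_norm_sq_to_K, inner_self_eq_norm_sq_to_K] at h2
    have h3 : ‖A (∑ i, c i • e i)‖ ^ 2 = ‖∑ i, c i • e i‖ ^ 2 := by exact_mod_cast h2
    exact (sq_eq_sq₀ (norm_nonneg _) (norm_nonneg _)).1 h3
  have hstep : ∀ x : ℂ, x ^ n = 1 → ∀ e : H, ‖e‖ = 1 → x • A e = e →
      (B ^ n) e = e ∧ B ((B ^ (n - 1)) e) = e ∧ ‖(B ^ (n - 1)) e‖ = 1 ∧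
        (ω * x) • A ((B ^ (n - 1)) e) = (B ^ (n - 1)) e := by
    intro x hx e he hAe
    obtain ⟨hi1, hi2⟩ := hinner x hx e he hAe
    obtain ⟨h1, h2, h3, h4⟩ := pow_sub_one_apply_properties (A := A) hB hn he hi1
    refine ⟨h1, h2, h3, ?_⟩
    have hroot' : (ω * x) ^ n = 1 := by rw [mul_pow, hωn, hx, one_mul]
    have hmem : (B ^ (n - 1)) e ∈ L := by
      rw [hL, ← mul_apply_eq_comp, (Commute.pow_pow_self B n (n - 1)).eq, mul_apply_eq_comp, h1]
    refine eq_of_inner_eq_one h3 ?_ ?_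
    · rw [norm_smul, Complex.norm_eq_one_of_pow_eq_one hroot' hn, one_mul, hiso _ hmem, h3]
    · rw [inner_smul_right, ← h4, hi2, mul_pow_sub_one hn, hroot']
  obtain ⟨e₀, he₀, hAe₀⟩ := hex 1 (one_pow n)
  -- Each application of `Bⁿ⁻¹` multiplies the eigenvalue of `A` by `ω⁻¹`, and `B` undoes it: `A yₖ
  -- = ω⁻ᵏ yₖ` and `B yₖ₊₁ = yₖ`.
  let y : ℕ → H := fun k => (⇑(B ^ (n - 1)))^[k] e₀
  have hy : ∀ k, ‖y k‖ = 1 ∧ ω ^ k • A (y k) = y k := by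
    intro k
    induction k with
    | zero => exact ⟨he₀, by simpa [y] using hAe₀⟩
    | succ k ih =>
      have h := hstep (ω ^ k) (hroot k) (y k) ih.1 ih.2
      have hs : y (k + 1) = (B ^ (n - 1)) (y k) := Function.iterate_succ_apply' _ _ _
      rw [hs, pow_succ']
      exact ⟨h.2.2.1, h.2.2.2⟩
  have hBy : ∀ k m, (B ^ k) (y (m + k)) = y m := by
    intro k m
    induction k with
    | zero => simp
    | succ k ih =>
      have hs : y (m + k + 1) = (B ^ (n - 1)) (y (m + k)) := Function.iterate_succ_apply' _ _ _
      rw [pow_succ, mul_apply_eq_comp, ← add_assoc, hs,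
        (hstep _ (hroot _) (y (m + k)) (hy _).1 (hy _).2).2.1, ih]
  -- Starting from `yₙ` leaves room for `n` steps back: `Bᵏ yₙ = yₙ₋ₖ` has eigenvalue `ωᵏ⁻ⁿ = ωᵏ`.
  refine ⟨y n, (hstep _ (hroot _) _ (hy n).1 (hy n).2).1, fun k hk => ?_⟩
  have h1 : (B ^ k) (y n) = y (n - k) := by
    have := hBy k (n - k)
    rwa [Nat.sub_add_cancel hk.le] at this
  rw [h1]
  refine ⟨(hy _).1, ?_⟩
  have h2 := congrArg (fun v => ω ^ k • v) (hy (n - k)).2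
  simp only [smul_smul, ← pow_add, Nat.add_sub_cancel' hk.le, hωn, one_smul] at h2
  exact h2

end ClockAndShiftPairs

/-! ### The invariant subspace -/

theorem mainTheorem3 {H : Type*} [NormedAddCommGroup H] [InnerProductSpace ℂ H] [CompleteSpace H]
    (A B : H →L[ℂ] H) (hA : IsStarNormal A) (hB : ‖B‖ = 1)
    (n : ℕ) (hn : 1 ≤ n) (ε : ℝ) (hε : 0 < ε)
    (hspec : ∀ j : Fin n,
      ∀ τ ∈ ({![rootOfUnity n ^ (j : ℕ), 0, 0, 0], ![0, rootOfUnity n ^ (j : ℕ), 0, 0]} :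
        Set (Fin 4 → ℂ)),
        properJointSpectrum ![A, B, A * B, B * A] ∩ polydisk τ ε =
          fourierSurface n ∩ polydisk τ ε)
    (hmult : ∀ j : Fin n,
      ∀ τ ∈ ({![rootOfUnity n ^ (j : ℕ), 0, 0, 0], ![0, rootOfUnity n ^ (j : ℕ), 0, 0]} :
        Set (Fin 4 → ℂ)),
        ∀ x ∈ fourierSurface n ∩ polydisk τ ε,
          HasJointMultiplicity ![A, B, A * B, B * A] x 1) :
    ∃ (L : Submodule ℂ H) (hAL : ∀ v ∈ L, A v ∈ L) (hBL : ∀ v ∈ L, B v ∈ L),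
      Module.finrank ℂ L = n ∧
      PairUnitarilyEquivalent (A.toLinearMap.restrict hAL) (B.toLinearMap.restrict hBL)
        (clockMatrix n) (shiftMatrix n) ∧
      (∃ e : OrthonormalBasis (Fin n) ℂ L,
        IsRootOfUnityEigenbasis (A.toLinearMap.restrict hAL) e) ∧
      (∃ ζ : OrthonormalBasis (Fin n) ℂ L,
        IsRootOfUnityEigenbasis (B.toLinearMap.restrict hBL) ζ) ∧
      ∀ e ζ : OrthonormalBasis (Fin n) ℂ L,
        IsRootOfUnityEigenbasis (A.toLinearMap.restrict hAL) e →
        IsRootOfUnityEigenbasis (B.toLinearMap.restrict hBL) ζ →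
        ∃ a b : Fin n → ℂ, (∀ j, ‖a j‖ = 1) ∧ (∀ j, ‖b j‖ = 1) ∧
          (Real.sqrt n : ℂ) • transitionMatrix e ζ =
            Matrix.diagonal a * fourierMatrix n * Matrix.diagonal b := by
  have hn0 : n ≠ 0 := by omega
  have : NeZero n := ⟨hn0⟩
  have hω := rootOfUnity_isPrimitiveRoot hn0
  have hωn := hω.pow_eq_one
  have hω0 : rootOfUnity n ≠ 0 := hω.ne_zero hn0
  have hroot : ∀ x : ℂ, x ^ n = 1 → ∃ j : Fin n, rootOfUnity n ^ (j : ℕ) = x := by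
    intro x hx
    obtain ⟨i, hi, hix⟩ := hω.eq_pow_of_pow_eq_one hx
    exact ⟨⟨i, hi⟩, hix⟩
  have hsing : ∀ x₀ : ℂ, x₀ ^ n = 1 → ∀ x y z₁ z₂ : ℂ,
      ‖x - x₀‖ < ε → ‖y‖ < ε → ‖z₁‖ < ε → ‖z₂‖ < ε →
      x ^ n + y ^ n + (-1) ^ (n - 1) * (rootOfUnity n * z₁ + z₂) ^ n = 1 →
      ¬ IsUnit (1 - (x • A + y • B + z₁ • (A * B) + z₂ • (B * A))) := by
    intro x₀ hx₀ x y z₁ z₂ h1 h2 h3 h4 h5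
    obtain ⟨j, rfl⟩ := hroot x₀ hx₀
    have hmem : ![x, y, z₁, z₂] ∈ fourierSurface n ∩
        polydisk ![rootOfUnity n ^ (j : ℕ), 0, 0, 0] ε := by
      refine ⟨by simpa [fourierSurface] using h5, ?_⟩
      simp [polydisk, Fin.forall_fin_succ, h1, h2, h3, h4]
    rw [← hspec j _ (Or.inl rfl)] at hmem
    have h6 : ¬ IsUnit (x • A + y • B + z₁ • (A * B) + z₂ • (B * A) - 1) := by
      simpa [properJointSpectrum, Fin.sum_univ_four] using hmem.1
    rw [← IsUnit.neg_iff, neg_sub]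
    exact h6
  have hmA : ∀ x : ℂ, x ^ n = 1 → IsIsolatedSpectralPointOfMultiplicity (x • A) 1 1 := by
    intro x hx
    obtain ⟨j, rfl⟩ := hroot x hx
    have := hmult j _ (Or.inl rfl) ![rootOfUnity n ^ (j : ℕ), 0, 0, 0]
      ⟨by simp [fourierSurface, hx, hn0], by simp [polydisk, hε]⟩
    simpa [HasJointMultiplicity, Fin.sum_univ_four] using this
  have hmB : ∀ x : ℂ, x ^ n = 1 → IsIsolatedSpectralPointOfMultiplicity (x • B) 1 1 := by
    intro x hx
    obtain ⟨j, rfl⟩ := hroot x hx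
    have := hmult j _ (Or.inr rfl) ![0, rootOfUnity n ^ (j : ℕ), 0, 0]
      ⟨by simp [fourierSurface, hx, hn0], by simp [polydisk, hε]⟩
    simpa [HasJointMultiplicity, Fin.sum_univ_four] using this
  have hnormal : ∀ x : ℂ, IsStarNormal (x • A) := fun x => inferInstance
  obtain ⟨g, hg, hgk⟩ := exists_cyclic_eigenvectors hA hB.le hn0 hω
    (fun x hx => ((hnormal x).isUnit_one_sub_add_rankOneOperator (hmA x hx)).1)
    (fun x hx e he hAe => inner_pow_apply_eq hn0 hωn hx hε (hsing x hx) he hAe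
      (fun v => (hnormal x).inner_apply_of_apply_eq hAe v)
      (((hnormal x).isUnit_one_sub_add_rankOneOperator (hmA x hx)).2 e he hAe))
    -- An eigenvector of `B` for `c` is one of `c⁻¹ B` for `1`, so multiplicity one is applied at
    -- `(0, c⁻¹, 0, 0)`.
    (fun c hc v w hv0 hv hw => by
      have hc0 : c ≠ 0 := by
        rintro rfl
        simp [hn0] at hc
      exact exists_smul_eq_of_isIsolatedSpectralPoint (hmB c⁻¹ (by rw [inv_pow, hc, inv_one])) hv0
        (by simp [hv, smul_smul, hc0]) (by simp [hw, smul_smul, hc0]))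
  let v : Fin n → H := fun k => (B ^ (k : ℕ)) g
  have hvA : ∀ k : Fin n, A (v k) = rootOfUnity n ^ (k : ℕ) • v k := fun k => (hgk k k.2).2
  have hvB : ∀ k l : Fin n, (l : ℕ) = ((k : ℕ) + 1) % n → B (v k) = v l := by
    intro k l hkl
    simp only [v]
    rw [← mul_apply_eq_comp, ← pow_succ']
    rcases Nat.lt_or_ge ((k : ℕ) + 1) n with h | h
    · rw [hkl, Nat.mod_eq_of_lt h]
    · have hk : (k : ℕ) + 1 = n := by omega
      rw [hkl, hk, Nat.mod_self, hg]
      simp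
  have hvon : Orthonormal ℂ v := hA.orthonormal_of_eigenvectors
    (c := fun k => (rootOfUnity n ^ (k : ℕ))⁻¹) (fun k => inv_ne_zero (pow_ne_zero _ hω0))
    (fun i j hij => Fin.ext (hω.pow_inj i.2 j.2 (inv_injective hij)))
    (fun k => (hgk k k.2).1)
    (fun k => by rw [hvA, inv_smul_smul₀ (pow_ne_zero _ hω0)])
  let L : Submodule ℂ H := Submodule.span ℂ (Set.range v)
  have hvL : ∀ k, v k ∈ L := fun k => Submodule.subset_span ⟨k, rfl⟩
  have hstable : ∀ T : H →L[ℂ] H, (∀ k, T (v k) ∈ L) → ∀ w ∈ L, T w ∈ L := by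
    intro T hT w hw
    have : L ≤ L.comap T.toLinearMap := by
      refine Submodule.span_le.2 ?_
      rintro _ ⟨k, rfl⟩
      exact hT k
    exact this hw
  have hAL := hstable A fun k => by rw [hvA]; exact L.smul_mem _ (hvL k)
  have hBL := hstable B fun k => by
    rw [hvB k ⟨((k : ℕ) + 1) % n, Nat.mod_lt _ hn⟩ rfl]
    exact hvL _
  have hfin : Module.finrank ℂ L = n := by
    simpa using finrank_span_eq_card hvon.linearIndependent
  have hvLon : Orthonormal ℂ fun k => (⟨v k, hvL k⟩ : L) :=
    ⟨fun k => hvon.1 k, fun i j hij => hvon.2 hij⟩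
  have : FiniteDimensional ℂ L := FiniteDimensional.span_of_finite ℂ (Set.finite_range v)
  obtain ⟨f, hf⟩ := hvLon.exists_orthonormalBasis_coe_eq hfin
  have hfA : ∀ k : Fin n, A.toLinearMap.restrict hAL (f k) = rootOfUnity n ^ (k : ℕ) • f k := by
    intro k
    rw [hf]
    exact Subtype.ext (hvA k)
  have hfB : ∀ k l : Fin n, (l : ℕ) = ((k : ℕ) + 1) % n →
      B.toLinearMap.restrict hBL (f k) = f l := by
    intro k l hkl
    rw [hf]
    exact Subtype.ext (hvB k l hkl)
  exact ⟨L, hAL, hBL, hfin, pairUnitarilyEquivalent_of_clock_shift f hfA hfB, ⟨f, hfA⟩,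
    exists_isRootOfUnityEigenbasis_of_shift f hn0 hfB,
    fun e ζ he hζ => transitionMatrix_eq_of_clock_shift f hn0 hfA hfB he hζ⟩
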